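/- Theorem (uniform curvature bound). Let $0<T^*<\infty$, let $S^1=\mathbb R/2\pi\mathbb Z$, and let $\kappa:S^1\times[0,T^*)\to\mathbb R$, $\kappa=\kappa(\theta,t)$, be continuous and nowhere zero, with $\kappa_\theta,\kappa_{\theta\theta},\kappa_t$ existing and continuous on $S^1\times(0,T^*)$. Suppose that $\kappa$ satisfies the curvature evolution equation $$\frac{\partial\kappa}{\partial t}=\big(\kappa^2+\lambda(t)\big)\kappa_{\theta\theta}-\frac{2\lambda(t)}{\kappa}\,\kappa_\theta^2+\kappa^3-\lambda(t)\,\kappa,\qquad \lambda(t)=\frac{2\pi}{\int_0^{2\pi}\kappa(\theta,t)^{-2}\,d\theta},$$ on $S^1\times(0,T^*)$, and that the initial value $\kappa_0=\kappa(\cdot,0)$ is the curvature, as a function of the tangent angle $\theta$, of a closed strictly convex plane curve, that is, $$\kappa_0>0\quad\text{and}\quad\int_0^{2\pi}\frac{e^{i\theta}}{\kappa_0(\theta)}\,d\theta=0 .$$ Then $\kappa$ is uniformly bounded on $S^1\times[0,T^*)$: there is a constant $C$ such that $|\kappa(\theta,t)|\le C$ for all $\theta\in S^1$ and all $t\in[0,T^*)$.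 -/

import Mathlib

open Set

/-- The nonlocal term `λ = 2π / ∮ (1/κ) ds` of a closed strictly convex curve whose curvature,
as a function of the tangent angle, is `k`. Since `ds = dθ / k`, the integral `∮ (1/κ) ds` is
`∫₀^{2π} 1 / k² dθ`. -/
noncomputable def nonlocalTerm (k : ℝ → ℝ) : ℝ :=
  2 * Real.pi / ∫ θ in (0 : ℝ)..(2 * Real.pi), 1 / (k θ) ^ 2

/-- `κ` is a classical solution of the curvature evolution equation
`κ_t = (κ² + λ(t)) κ_θθ - (2 λ(t) / κ) κ_θ² + κ³ - λ(t) κ`, with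
`λ(t) = 2π / ∫₀^{2π} κ(θ,t)⁻² dθ`, on `S¹ × [0, T)`. Functions on `S¹` are `2π`-periodic functions
on `ℝ`; the first argument of `κ` is the angle `θ`, the second is the time `t`. The function is
continuous up to the initial time, and it is of class `C^{2,1}` and satisfies the equation at
positive times. It has no zero, so that the quotients in the equation make sense. -/
structure IsCurvatureFlowSolution (T : ℝ) (κ : ℝ → ℝ → ℝ) : Prop where
  periodic : ∀ t ∈ Ico 0 T, Function.Periodic (fun θ => κ θ t) (2 * Real.pi)
  continuousOn : ContinuousOn (fun p : ℝ × ℝ => κ p.1 p.2) (univ ×ˢ Ico 0 T)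
  ne_zero : ∀ θ : ℝ, ∀ t ∈ Ico 0 T, κ θ t ≠ 0
  contDiff_angle : ∀ t ∈ Ioo 0 T, ContDiff ℝ 2 (fun θ => κ θ t)
  differentiableAt_time : ∀ θ : ℝ, ∀ t ∈ Ioo 0 T, DifferentiableAt ℝ (fun s => κ θ s) t
  continuousOn_deriv_angle :
    ContinuousOn (fun p : ℝ × ℝ => deriv (fun θ => κ θ p.2) p.1) (univ ×ˢ Ioo 0 T)
  continuousOn_deriv_angle_two :
    ContinuousOn (fun p : ℝ × ℝ => iteratedDeriv 2 (fun θ => κ θ p.2) p.1) (univ ×ˢ Ioo 0 T)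
  continuousOn_deriv_time :
    ContinuousOn (fun p : ℝ × ℝ => deriv (fun s => κ p.1 s) p.2) (univ ×ˢ Ioo 0 T)
  equation : ∀ θ : ℝ, ∀ t ∈ Ioo 0 T,
    deriv (fun s => κ θ s) t =
      ((κ θ t) ^ 2 + nonlocalTerm (fun φ => κ φ t)) * iteratedDeriv 2 (fun φ => κ φ t) θ
        - 2 * nonlocalTerm (fun φ => κ φ t) / κ θ t * (deriv (fun φ => κ φ t) θ) ^ 2
        + (κ θ t) ^ 3 - nonlocalTerm (fun φ => κ φ t) * κ θ t

/-! Write `ρ = 1/κ`. The equation says `ρ_t = S_θθ + S` with `S = λρ - κ`: convex curves with radius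
of curvature `ρ` move with outward normal speed `S`, and their support functions, which satisfy
`h_θθ + h = ρ`, obey `h_t = S`. The equation and the closing condition are invariant under rotation,
so `θ` may be read as the angle of the normal.

The choice of `λ` makes the enclosed area constant (`integral_speed_mul_radius`), and Cauchy-Schwarz
makes the length nonincreasing (`integral_speed_nonpos`). Since every curve contains a disc of
radius area/length (`exists_center`), the inradius has a positive lower bound `r` independent of
time.

Because `T` is finite, one can start at a time `b` so close to `T` that a disc inside the curve at
time `b` cannot be swept out before `T`: a barrier circle shrinks too slowly (`half_lt_support`).
Now `h` is bounded below for a fixed origin. The maximum principle for `κ - M (h - r/4)` then gives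
`κ ≤ M h` (`exists_le_mul_support`): where this function attains a zero maximum, subtracting `r/4`
from `h` leaves a term of order `-κ²`, which beats the remaining `2Mκ`. Finally `h` is at most the
length, hence bounded. On `[0, b]` compactness suffices. -/

open Filter Topology

/-! ### Calculus of one variable -/

/-- At a maximum the second derivative is nonpositive. -/
theorem second_deriv_nonpos_of_forall_le {f f' : ℝ → ℝ} {f'' x : ℝ}
    (hf : ∀ y, HasDerivAt f (f' y) y) (hf' : HasDerivAt f' f'' x) (hx : ∀ y, f y ≤ f x) :
    f'' ≤ 0 := by
  by_contra! hpos
  have hd : deriv f = f' := funext fun y => (hf y).deriv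
  have hmax : IsLocalMax f x := Eventually.of_forall hx
  -- With a positive second derivative the maximum is a local minimum as well, so `f` is locally
  -- constant and its second derivative vanishes.
  have hmin : IsLocalMin f x := by
    refine isLocalMin_of_deriv_deriv_pos ?_ hmax.deriv_eq_zero (hf x).continuousAt
    rw [hd, hf'.deriv]
    exact hpos
  have hconst : f =ᶠ[𝓝 x] fun _ => f x := by
    filter_upwards [hmin] with y hy using le_antisymm (hx y) hy
  have h1 : f' =ᶠ[𝓝 x] fun _ => 0 := by
    filter_upwards [hconst.eventuallyEq_nhds] with y hy
    rw [← hd, hy.deriv_eq, deriv_const]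
  have h2 := h1.deriv_eq
  rw [hf'.deriv, deriv_const] at h2
  exact hpos.ne' h2

/-- The integral over a period of the derivative of a periodic function vanishes. -/
theorem integral_deriv_eq_zero_of_periodic {f f' : ℝ → ℝ} {c : ℝ}
    (hf : ∀ x, HasDerivAt f (f' x) x) (hf' : Continuous f') (hper : Function.Periodic f c) (a : ℝ) :
    ∫ x in a..(a + c), f' x = 0 := by
  rw [intervalIntegral.integral_eq_sub_of_hasDerivAt (fun x _ => hf x)
    (hf'.intervalIntegrable _ _), hper a, sub_self]

/-- A function on `[a, b]` that is continuous there, and whose derivative in the interior is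
nonpositive, does not increase from `a` to `b`. -/
theorem le_of_hasDerivAt_nonpos {f f' : ℝ → ℝ} {a b : ℝ} (hab : a ≤ b)
    (hc : ContinuousOn f (Icc a b)) (hf : ∀ x ∈ Ioo a b, HasDerivAt f (f' x) x)
    (hf' : ∀ x ∈ Ioo a b, f' x ≤ 0) : f b ≤ f a := by
  refine antitoneOn_of_deriv_nonpos (convex_Icc a b) hc ?_ ?_ (left_mem_Icc.2 hab)
    (right_mem_Icc.2 hab) hab
  · rw [interior_Icc]
    exact fun x hx => (hf x hx).differentiableAt.differentiableWithinAt
  · rw [interior_Icc]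
    intro x hx
    rw [(hf x hx).deriv]
    exact hf' x hx

/-- A function on `[a, b]` that is continuous there, and whose derivative in the interior
vanishes, takes the same value at `a` and at `b`. -/
theorem eq_of_hasDerivAt_zero {f f' : ℝ → ℝ} {a b : ℝ} (hab : a ≤ b)
    (hc : ContinuousOn f (Icc a b)) (hf : ∀ x ∈ Ioo a b, HasDerivAt f (f' x) x)
    (hf' : ∀ x ∈ Ioo a b, f' x = 0) : f b = f a := by
  refine le_antisymm (le_of_hasDerivAt_nonpos hab hc hf fun x hx => (hf' x hx).le) ?_
  have := le_of_hasDerivAt_nonpos hab hc.neg (fun x hx => (hf x hx).neg)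
    fun x hx => by simp [hf' x hx]
  simpa using this

/-! ### Integrals depending on a parameter -/

/-- Differentiation under the integral sign over a compact interval. -/
theorem hasDerivAt_intervalIntegral_of_continuousOn {g g' : ℝ → ℝ → ℝ} {U : Set ℝ} (hU : IsOpen U)
    {a b : ℝ} (hab : a ≤ b)
    (hg : ContinuousOn (fun p : ℝ × ℝ => g p.1 p.2) (U ×ˢ Icc a b))
    (hg' : ContinuousOn (fun p : ℝ × ℝ => g' p.1 p.2) (U ×ˢ Icc a b))
    (hd : ∀ x ∈ U, ∀ s ∈ Icc a b, HasDerivAt (fun y => g y s) (g' x s) x)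
    {x : ℝ} (hx : x ∈ U) :
    HasDerivAt (fun y => ∫ s in a..b, g y s) (∫ s in a..b, g' x s) x := by
  obtain ⟨ε, hε, hball⟩ := Metric.nhds_basis_closedBall.mem_iff.1 (hU.mem_nhds hx)
  have hslice : ∀ f : ℝ → ℝ → ℝ, ContinuousOn (fun p : ℝ × ℝ => f p.1 p.2) (U ×ˢ Icc a b) →
      ∀ y ∈ U, ContinuousOn (f y) (Icc a b) := fun f hf y hy =>
    hf.comp (f := fun s => (y, s)) (by fun_prop) fun s hs => ⟨hy, hs⟩
  obtain ⟨C, hC⟩ := ((isCompact_closedBall x ε).prod (isCompact_Icc (a := a) (b := b))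
    ).exists_bound_of_continuousOn (hg'.mono (prod_mono hball Subset.rfl))
  have hsub : Set.uIoc a b ⊆ Icc a b := by
    rw [uIoc_of_le hab]
    exact Ioc_subset_Icc_self
  have hmeas : ∀ f : ℝ → ℝ, ContinuousOn f (Icc a b) → MeasureTheory.AEStronglyMeasurable f
      (MeasureTheory.volume.restrict (Set.uIoc a b)) := fun f hf =>
    (hf.mono hsub).aestronglyMeasurable measurableSet_uIoc
  refine (intervalIntegral.hasDerivAt_integral_of_dominated_loc_of_deriv_le (bound := fun _ => C)
    (Metric.closedBall_mem_nhds x hε) ?_ ?_ ?_ ?_ (by simp) ?_).2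
  · filter_upwards [hU.mem_nhds hx] with y hy using hmeas _ (hslice g hg y hy)
  · refine ContinuousOn.intervalIntegrable ?_
    rw [uIcc_of_le hab]
    exact hslice g hg x hx
  · exact hmeas _ (hslice g' hg' x hx)
  · exact Eventually.of_forall fun s hs y hy => hC (y, s) ⟨hy, hsub hs⟩
  · exact Eventually.of_forall fun s hs y hy => hd y (hball hy) s (hsub hs)

/-- The integral in the first variable of a continuous function of two variables depends
continuously on the second variable. -/
theorem continuousOn_intervalIntegral_fst {g : ℝ → ℝ → ℝ} {J : Set ℝ}
    (hg : ContinuousOn (fun p : ℝ × ℝ => g p.1 p.2) (univ ×ˢ J)) (a b : ℝ) :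
    ContinuousOn (fun t => ∫ x in a..b, g x t) J := by
  rw [continuousOn_iff_continuous_domRestrict]
  refine intervalIntegral.continuous_parametric_intervalIntegral_of_continuous'
    (f := fun (t : J) x => g x t) ?_ a b
  exact hg.comp_continuous (f := fun p : J × ℝ => (p.2, (p.1 : ℝ))) (by fun_prop)
    fun p => ⟨mem_univ _, p.1.2⟩

/-- Differentiation of the integral in the first variable with respect to the second one. -/
theorem hasDerivAt_intervalIntegral_fst {g g' : ℝ → ℝ → ℝ} {J : Set ℝ} (hJ : IsOpen J)
    (hg : ContinuousOn (fun p : ℝ × ℝ => g p.1 p.2) (univ ×ˢ J))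
    (hg' : ContinuousOn (fun p : ℝ × ℝ => g' p.1 p.2) (univ ×ˢ J))
    (hd : ∀ x, ∀ t ∈ J, HasDerivAt (fun s => g x s) (g' x t) t)
    {a b : ℝ} (hab : a ≤ b) {t : ℝ} (ht : t ∈ J) :
    HasDerivAt (fun s => ∫ x in a..b, g x s) (∫ x in a..b, g' x t) t := by
  have hswap : ∀ f : ℝ → ℝ → ℝ, ContinuousOn (fun p : ℝ × ℝ => f p.1 p.2) (univ ×ˢ J) →
      ContinuousOn (fun p : ℝ × ℝ => f p.2 p.1) (J ×ˢ Icc a b) := fun f hf =>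
    hf.comp (f := fun p : ℝ × ℝ => (p.2, p.1)) (by fun_prop) fun p hp => ⟨mem_univ _, hp.1⟩
  exact hasDerivAt_intervalIntegral_of_continuousOn (g := fun s x => g x s)
    (g' := fun s x => g' x s) hJ hab (hswap g hg) (hswap g' hg') (fun s hs x _ => hd x s hs) ht

/-! ### The maximum principle -/

/-- A function that is periodic in `θ`, negative at the initial time, and decreasing in time
wherever it attains the spatial maximum `0`, stays negative. -/
theorem neg_of_deriv_neg_at_spatial_max {f f' : ℝ → ℝ → ℝ} {c a b : ℝ} (hc : 0 < c)
    (hf : ContinuousOn (fun p : ℝ × ℝ => f p.1 p.2) (univ ×ˢ Ico a b))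
    (hper : ∀ t ∈ Ico a b, Function.Periodic (fun θ => f θ t) c)
    (hd : ∀ θ, ∀ t ∈ Ioo a b, HasDerivAt (fun s => f θ s) (f' θ t) t)
    (hinit : ∀ θ, f θ a < 0)
    (hmax : ∀ θ, ∀ t ∈ Ioo a b, f θ t = 0 → (∀ φ, f φ t ≤ 0) → f' θ t < 0) :
    ∀ θ, ∀ t ∈ Ico a b, f θ t < 0 := by
  by_contra! hcon
  obtain ⟨θ₁, t₁, ht₁, hpos⟩ := hcon
  have hsub : Icc (0 : ℝ) c ×ˢ Icc a t₁ ⊆ univ ×ˢ Ico a b :=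
    prod_mono (subset_univ _) (Icc_subset_Ico_right ht₁.2)
  -- Periodicity confines the bad points to a compact set; one with least time marks the first time
  -- at which `f` is nonnegative.
  have hK : IsCompact ((Icc (0 : ℝ) c ×ˢ Icc a t₁) ∩ {p : ℝ × ℝ | 0 ≤ f p.1 p.2}) := by
    refine (isCompact_Icc.prod isCompact_Icc).of_isClosed_subset ?_ inter_subset_left
    exact (hf.mono hsub).preimage_isClosed_of_isClosed (isClosed_Icc.prod isClosed_Icc) isClosed_Ici
  have hred : ∀ θ, ∀ t ∈ Icc a t₁, 0 ≤ f θ t →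
      ∃ φ, (φ, t) ∈ (Icc (0 : ℝ) c ×ˢ Icc a t₁) ∩ {p : ℝ × ℝ | 0 ≤ f p.1 p.2} := by
    intro θ t ht h0
    obtain ⟨φ, hφ, heq⟩ := (hper t ⟨ht.1, ht.2.trans_lt ht₁.2⟩).exists_mem_Ico₀ hc θ
    exact ⟨φ, ⟨⟨Ico_subset_Icc_self hφ, ht⟩, by simpa [← heq] using h0⟩⟩
  obtain ⟨φ₁, hφ₁⟩ := hred θ₁ t₁ ⟨ht₁.1, le_rfl⟩ hpos
  obtain ⟨⟨θ, t⟩, ⟨⟨-, ht⟩, h0⟩, hmin⟩ := hK.exists_isMinOn ⟨_, hφ₁⟩ continuous_snd.continuousOn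
  simp only [mem_ofPred_eq] at h0 ht
  have hbefore : ∀ φ, ∀ s ∈ Ico a t, f φ s < 0 := by
    intro φ s hs
    by_contra! hge
    obtain ⟨ψ, hψ⟩ := hred φ s ⟨hs.1, hs.2.le.trans ht.2⟩ hge
    have : t ≤ s := hmin hψ
    exact this.not_gt hs.2
  have hat : a < t := by
    rcases ht.1.eq_or_lt with h | h
    · rw [← h] at h0
      exact absurd (hinit θ) h0.not_gt
    · exact h
  have ht' : t ∈ Ioo a b := ⟨hat, ht.2.trans_lt ht₁.2⟩
  have hle : ∀ φ, f φ t ≤ 0 := by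
    intro φ
    have hlim : Tendsto (fun s => f φ s) (𝓝[<] t) (𝓝 (f φ t)) :=
      (hd φ t ht').continuousAt.tendsto.mono_left nhdsWithin_le_nhds
    refine le_of_tendsto hlim ?_
    filter_upwards [Ico_mem_nhdsLT hat] with s hs using (hbefore φ s hs).le
  have hz : f θ t = 0 := le_antisymm (hle θ) h0
  have hneg := hmax θ t ht' hz hle
  have hslope := (hasDerivAt_iff_tendsto_slope_left_right.1 (hd θ t ht')).1
  -- Before the first bad time `f` is negative, so the difference quotients from the left are
  -- positive.
  have : 0 ≤ f' θ t := by
    refine ge_of_tendsto hslope ?_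
    filter_upwards [Ico_mem_nhdsLT hat] with s hs
    rw [slope_def_field, hz]
    exact (div_pos_of_neg_of_neg (by linarith [hbefore θ s hs]) (by linarith [hs.2])).le
  exact hneg.not_ge this

/-! ### Support functions of convex curves -/

/-- `h` is the support function, with derivative `h'`, of a closed convex curve whose radius of
curvature, as a function of the angle of the normal, is the positive continuous function `ρ`. -/
structure IsSupportFunction (h h' ρ : ℝ → ℝ) : Prop where
  hasDerivAt : ∀ θ, HasDerivAt h (h' θ) θ
  hasDerivAt' : ∀ θ, HasDerivAt h' (ρ θ - h θ) θ
  periodic : Function.Periodic h (2 * Real.pi)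
  continuous : Continuous ρ
  pos : ∀ θ, 0 < ρ θ

namespace IsSupportFunction

variable {h h' ρ : ℝ → ℝ}

theorem continuous_self (H : IsSupportFunction h h' ρ) : Continuous h :=
  continuous_iff_continuousAt.2 fun θ => (H.hasDerivAt θ).continuousAt

theorem continuous_deriv (H : IsSupportFunction h h' ρ) : Continuous h' :=
  continuous_iff_continuousAt.2 fun θ => (H.hasDerivAt' θ).continuousAt

theorem periodic_deriv (H : IsSupportFunction h h' ρ) : Function.Periodic h' (2 * Real.pi) := by
  intro θ
  have h1 := (H.hasDerivAt (θ + 2 * Real.pi)).comp_add_const θ (2 * Real.pi)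
  rw [funext H.periodic] at h1
  exact h1.unique (H.hasDerivAt θ)

theorem periodic_radius (H : IsSupportFunction h h' ρ) : Function.Periodic ρ (2 * Real.pi) := by
  intro θ
  have h1 := (H.hasDerivAt' (θ + 2 * Real.pi)).comp_add_const θ (2 * Real.pi)
  rw [funext H.periodic_deriv] at h1
  have h2 := h1.unique (H.hasDerivAt' θ)
  have h3 := H.periodic θ
  linarith

theorem integral_radius_pos (H : IsSupportFunction h h' ρ) : 0 < ∫ θ in 0..(2 * Real.pi), ρ θ :=
  intervalIntegral.intervalIntegral_pos_of_pos (H.continuous.intervalIntegrable _ _) H.pos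
    Real.two_pi_pos

/-- The distance of the boundary point with normal angle `θ` to the supporting line with normal
angle `θ₀`, as a function of `θ`, has the derivative `ρ θ * sin (θ - θ₀)`. -/
theorem hasDerivAt_depth (H : IsSupportFunction h h' ρ) (θ₀ θ : ℝ) :
    HasDerivAt (fun x => h θ₀ - (h x * Real.cos (x - θ₀) - h' x * Real.sin (x - θ₀)))
      (ρ θ * Real.sin (θ - θ₀)) θ := by
  have hs : HasDerivAt (fun x : ℝ => x - θ₀) 1 θ := (hasDerivAt_id θ).sub_const θ₀
  refine ((((H.hasDerivAt θ).mul hs.cos).sub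
    ((H.hasDerivAt' θ).mul hs.sin)).const_sub (h θ₀)).congr_deriv ?_
  ring

/-- Every boundary point lies on the inner side of every supporting line. -/
theorem depth_nonneg (H : IsSupportFunction h h' ρ) (θ₀ θ : ℝ) :
    0 ≤ h θ₀ - (h θ * Real.cos (θ - θ₀) - h' θ * Real.sin (θ - θ₀)) := by
  set d : ℝ → ℝ := fun x => h θ₀ - (h x * Real.cos (x - θ₀) - h' x * Real.sin (x - θ₀)) with hd
  have hder : ∀ x, HasDerivAt d (ρ x * Real.sin (x - θ₀)) x := H.hasDerivAt_depth θ₀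
  have hcont : Continuous d := continuous_iff_continuousAt.2 fun x => (hder x).continuousAt
  have hper : Function.Periodic d (2 * Real.pi) := by
    intro x
    simp only [hd]
    rw [H.periodic x, H.periodic_deriv x, show x + 2 * Real.pi - θ₀ = x - θ₀ + 2 * Real.pi by ring,
      Real.cos_add_two_pi, Real.sin_add_two_pi]
  have h0 : d θ₀ = 0 := by simp [hd]
  -- Within a half-turn of `θ₀` the derivative `ρ sin (x - θ₀)` has the sign of `x - θ₀`, so the
  -- depth is smallest at `θ₀`, where it is zero.
  obtain ⟨x, hx, hxθ⟩ := hper.exists_mem_Ico Real.two_pi_pos θ (θ₀ - Real.pi)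
  change 0 ≤ d θ
  rw [hxθ]
  rcases le_total x θ₀ with hle | hle
  · rw [← h0]
    refine le_of_hasDerivAt_nonpos hle hcont.continuousOn (fun y _ => hder y) fun y hy => ?_
    exact mul_nonpos_of_nonneg_of_nonpos (H.pos y).le
      (Real.sin_nonpos_of_nonpos_of_neg_pi_le (by linarith [hy.2]) (by linarith [hx.1, hy.1]))
  · have := le_of_hasDerivAt_nonpos hle hcont.neg.continuousOn (fun y _ => (hder y).neg)
      fun y hy => neg_nonpos.2 (mul_nonneg (H.pos y).le
        (Real.sin_nonneg_of_nonneg_of_le_pi (by linarith [hy.1]) (by linarith [hx.2, hy.2])))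
    simp only [Pi.neg_apply] at this
    linarith

/-- The width of the curve in terms of the radius of curvature. -/
theorem width_eq (H : IsSupportFunction h h' ρ) (θ : ℝ) :
    h θ + h (θ + Real.pi) = ∫ x in θ..(θ + Real.pi), ρ x * Real.sin (x - θ) := by
  rw [intervalIntegral.integral_eq_sub_of_hasDerivAt (fun x _ => H.hasDerivAt_depth θ x)
    ((H.continuous.mul (by fun_prop)).intervalIntegrable _ _)]
  simp

/-- The width of the curve is at most its length. -/
theorem width_le (H : IsSupportFunction h h' ρ) (θ : ℝ) :
    h θ + h (θ + Real.pi) ≤ ∫ x in 0..(2 * Real.pi), ρ x := by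
  have hint : ∀ a b : ℝ, IntervalIntegrable ρ MeasureTheory.volume a b :=
    fun a b => H.continuous.intervalIntegrable a b
  have hper : ∫ x in θ..(θ + 2 * Real.pi), ρ x = ∫ x in 0..(2 * Real.pi), ρ x := by
    simpa using H.periodic_radius.intervalIntegral_add_eq θ 0
  have hsplit : (∫ x in θ..(θ + Real.pi), ρ x) + ∫ x in (θ + Real.pi)..(θ + 2 * Real.pi), ρ x =
      ∫ x in θ..(θ + 2 * Real.pi), ρ x :=
    intervalIntegral.integral_add_adjacent_intervals (hint _ _) (hint _ _)
  have hrest : 0 ≤ ∫ x in (θ + Real.pi)..(θ + 2 * Real.pi), ρ x :=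
    intervalIntegral.integral_nonneg (by linarith [Real.pi_pos]) fun x _ => (H.pos x).le
  have hle : ∫ x in θ..(θ + Real.pi), ρ x * Real.sin (x - θ) ≤ ∫ x in θ..(θ + Real.pi), ρ x :=
    intervalIntegral.integral_mono_on (by linarith [Real.pi_pos])
      ((H.continuous.mul (by fun_prop)).intervalIntegrable _ _) (hint _ _)
      fun x _ => mul_le_of_le_one_right (H.pos x).le (Real.sin_le_one _)
  rw [H.width_eq θ]
  linarith

theorem width_pos (H : IsSupportFunction h h' ρ) (θ : ℝ) : 0 < h θ + h (θ + Real.pi) := by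
  rw [H.width_eq θ]
  refine intervalIntegral.intervalIntegral_pos_of_pos_on
    ((H.continuous.mul (by fun_prop)).intervalIntegrable _ _) (fun x hx => ?_)
    (by linarith [Real.pi_pos])
  exact mul_pos (H.pos x) (Real.sin_pos_of_pos_of_lt_pi (by linarith [hx.1]) (by linarith [hx.2]))

/-- A support function is at most the length of the curve if it is nonnegative. -/
theorem le_integral_radius (H : IsSupportFunction h h' ρ) (hnn : ∀ θ, 0 ≤ h θ) (θ : ℝ) :
    h θ ≤ ∫ x in 0..(2 * Real.pi), ρ x := by
  linarith [H.width_le θ, hnn (θ + Real.pi)]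

/-- If the origin is the boundary point with normal angle `0`, then the area is positive. -/
theorem integral_mul_radius_pos (H : IsSupportFunction h h' ρ) (h0 : h 0 = 0) (h0' : h' 0 = 0) :
    0 < ∫ θ in 0..(2 * Real.pi), h θ * ρ θ := by
  -- The origin is itself a boundary point, so its depth below the supporting line at `θ` is `h θ`.
  have hnn : ∀ θ, 0 ≤ h θ := fun θ => by simpa [h0, h0'] using H.depth_nonneg θ 0
  have hpi : 0 < h Real.pi := by simpa [h0] using H.width_pos 0
  exact intervalIntegral.integral_pos Real.two_pi_pos (H.continuous_self.mul H.continuous).continuousOn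
    (fun θ _ => mul_nonneg (hnn θ) (H.pos θ).le)
    ⟨Real.pi, ⟨Real.pi_pos.le, by linarith [Real.pi_pos]⟩, mul_pos hpi (H.pos _)⟩

/-- The curve encloses, with respect to the direction `θ₀`, the area `∫ x dy`. -/
theorem integral_coord_mul_eq (H : IsSupportFunction h h' ρ) (θ₀ : ℝ) :
    ∫ θ in 0..(2 * Real.pi), (h θ * Real.cos (θ - θ₀) - h' θ * Real.sin (θ - θ₀)) *
      (ρ θ * Real.cos (θ - θ₀)) = (∫ θ in 0..(2 * Real.pi), h θ * ρ θ) / 2 := by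
  have c1 := H.continuous_self
  have c2 := H.continuous_deriv
  have c3 := H.continuous
  -- This is the product `x y` of the coordinates along and across `θ₀`, where `x' = -ρ sin`, `y' =
  -- ρ cos` and `h = x cos + y sin`.
  have hprod : ∀ θ, HasDerivAt
      (fun x => (h x * Real.cos (x - θ₀) - h' x * Real.sin (x - θ₀)) *
        (h x * Real.sin (x - θ₀) + h' x * Real.cos (x - θ₀)))
      (2 * ((h θ * Real.cos (θ - θ₀) - h' θ * Real.sin (θ - θ₀)) * (ρ θ * Real.cos (θ - θ₀))) -
        h θ * ρ θ) θ := by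
    intro θ
    have hs : HasDerivAt (fun x : ℝ => x - θ₀) 1 θ := (hasDerivAt_id θ).sub_const θ₀
    have := (((H.hasDerivAt θ).mul hs.cos).sub ((H.hasDerivAt' θ).mul hs.sin)).mul
      (((H.hasDerivAt θ).mul hs.sin).add ((H.hasDerivAt' θ).mul hs.cos))
    refine this.congr_deriv ?_
    simp only [Pi.mul_apply, Pi.sub_apply, Pi.add_apply]
    linear_combination -(h θ * ρ θ) * (Real.sin_sq_add_cos_sq (θ - θ₀))
  have hzero := integral_deriv_eq_zero_of_periodic hprod (by fun_prop) (c := 2 * Real.pi) (fun x => by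
    simp only
    rw [H.periodic x, H.periodic_deriv x, show x + 2 * Real.pi - θ₀ = x - θ₀ + 2 * Real.pi by ring,
      Real.cos_add_two_pi, Real.sin_add_two_pi]) 0
  rw [zero_add, intervalIntegral.integral_sub (Continuous.intervalIntegrable (by fun_prop) _ _)
    (Continuous.intervalIntegrable (by fun_prop) _ _), intervalIntegral.integral_const_mul] at hzero
  linarith

/-- The integrand is the derivative of the coordinate across `θ₀`, which returns to its value after
one turn. -/
theorem integral_radius_mul_cos (H : IsSupportFunction h h' ρ) (θ₀ : ℝ) :
    ∫ θ in 0..(2 * Real.pi), ρ θ * Real.cos (θ - θ₀) = 0 := by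
  have hder : ∀ θ, HasDerivAt (fun x => h x * Real.sin (x - θ₀) + h' x * Real.cos (x - θ₀))
      (ρ θ * Real.cos (θ - θ₀)) θ := by
    intro θ
    have hs : HasDerivAt (fun x : ℝ => x - θ₀) 1 θ := (hasDerivAt_id θ).sub_const θ₀
    refine (((H.hasDerivAt θ).mul hs.sin).add ((H.hasDerivAt' θ).mul hs.cos)).congr_deriv ?_
    ring
  have := integral_deriv_eq_zero_of_periodic hder (H.continuous.mul (by fun_prop))
    (c := 2 * Real.pi) (fun x => by
      simp only
      rw [H.periodic x, H.periodic_deriv x,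
        show x + 2 * Real.pi - θ₀ = x - θ₀ + 2 * Real.pi by ring,
        Real.cos_add_two_pi, Real.sin_add_two_pi]) 0
  simpa using this

/-- **Inradius estimate**: seen from the centroid of the curve, the support function is at least the
quotient of area and length. -/
theorem exists_center (H : IsSupportFunction h h' ρ) :
    ∃ a b : ℝ, ∀ θ, (∫ x in 0..(2 * Real.pi), h x * ρ x) / 2 / (∫ x in 0..(2 * Real.pi), ρ x) ≤
      h θ - a * Real.cos θ - b * Real.sin θ := by
  have c1 := H.continuous_self
  have c2 := H.continuous_deriv
  have c3 := H.continuous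
  set L := ∫ x in 0..(2 * Real.pi), ρ x with hL
  have hLpos : 0 < L := H.integral_radius_pos
  set a := ∫ x in 0..(2 * Real.pi), (h x * Real.cos x - h' x * Real.sin x) * ρ x with ha
  set b := ∫ x in 0..(2 * Real.pi), (h x * Real.sin x + h' x * Real.cos x) * ρ x with hb
  refine ⟨a / L, b / L, fun θ => ?_⟩
  have hcoord : ∫ x in 0..(2 * Real.pi),
      (h x * Real.cos (x - θ) - h' x * Real.sin (x - θ)) * ρ x =
        a * Real.cos θ + b * Real.sin θ := by
    rw [ha, hb, ← intervalIntegral.integral_mul_const, ← intervalIntegral.integral_mul_const,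
      ← intervalIntegral.integral_add (Continuous.intervalIntegrable (by fun_prop) _ _)
        (Continuous.intervalIntegrable (by fun_prop) _ _)]
    refine intervalIntegral.integral_congr fun x _ => ?_
    simp only [Real.cos_sub, Real.sin_sub]
    ring
  -- The weight `1 + cos` is nonnegative. Its constant part produces length and centroid (with
  -- respect to arc length). In its cosine part the `h θ` term drops out by closedness, and the
  -- coordinate term gives the area.
  have hnn : 0 ≤ ∫ x in 0..(2 * Real.pi),
      (h θ - (h x * Real.cos (x - θ) - h' x * Real.sin (x - θ))) *
        (ρ x * (1 + Real.cos (x - θ))) :=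
    intervalIntegral.integral_nonneg Real.two_pi_pos.le fun x _ =>
      mul_nonneg (H.depth_nonneg θ x)
        (mul_nonneg (H.pos x).le (by linarith [Real.neg_one_le_cos (x - θ)]))
  have hexp : ∫ x in 0..(2 * Real.pi),
      (h θ - (h x * Real.cos (x - θ) - h' x * Real.sin (x - θ))) *
        (ρ x * (1 + Real.cos (x - θ))) =
      h θ * L + h θ * (∫ x in 0..(2 * Real.pi), ρ x * Real.cos (x - θ)) -
        (∫ x in 0..(2 * Real.pi), (h x * Real.cos (x - θ) - h' x * Real.sin (x - θ)) * ρ x) -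
        ∫ x in 0..(2 * Real.pi), (h x * Real.cos (x - θ) - h' x * Real.sin (x - θ)) *
          (ρ x * Real.cos (x - θ)) := by
    rw [hL, ← intervalIntegral.integral_const_mul, ← intervalIntegral.integral_const_mul,
      ← intervalIntegral.integral_add (Continuous.intervalIntegrable (by fun_prop) _ _)
        (Continuous.intervalIntegrable (by fun_prop) _ _),
      ← intervalIntegral.integral_sub (Continuous.intervalIntegrable (by fun_prop) _ _)
        (Continuous.intervalIntegrable (by fun_prop) _ _),
      ← intervalIntegral.integral_sub (Continuous.intervalIntegrable (by fun_prop) _ _)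
        (Continuous.intervalIntegrable (by fun_prop) _ _)]
    refine intervalIntegral.integral_congr fun x _ => ?_
    ring
  rw [hexp, H.integral_radius_mul_cos, hcoord, H.integral_coord_mul_eq] at hnn
  rw [div_le_iff₀ hLpos]
  have : (h θ - a / L * Real.cos θ - b / L * Real.sin θ) * L =
      h θ * L - (a * Real.cos θ + b * Real.sin θ) := by
    field_simp
    ring
  rw [this]
  linarith

end IsSupportFunction

/-- A positive continuous periodic function satisfying the closing condition is the radius of
curvature of a closed convex curve, which may be assumed to pass through the origin. -/
theorem exists_isSupportFunction {ρ : ℝ → ℝ} (hc : Continuous ρ) (hpos : ∀ θ, 0 < ρ θ)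
    (hper : Function.Periodic ρ (2 * Real.pi))
    (hcos : ∫ θ in 0..(2 * Real.pi), ρ θ * Real.cos θ = 0)
    (hsin : ∫ θ in 0..(2 * Real.pi), ρ θ * Real.sin θ = 0) :
    ∃ h h' : ℝ → ℝ, IsSupportFunction h h' ρ ∧ h 0 = 0 ∧ h' 0 = 0 := by
  set C : ℝ → ℝ := fun θ => ∫ x in 0..θ, ρ x * Real.cos x with hC
  set S : ℝ → ℝ := fun θ => ∫ x in 0..θ, ρ x * Real.sin x with hS
  have hcC : Continuous fun x => ρ x * Real.cos x := by fun_prop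
  have hcS : Continuous fun x => ρ x * Real.sin x := by fun_prop
  have hdC : ∀ θ, HasDerivAt C (ρ θ * Real.cos θ) θ := fun θ => hcC.integral_hasStrictDerivAt 0 θ
    |>.hasDerivAt
  have hdS : ∀ θ, HasDerivAt S (ρ θ * Real.sin θ) θ := fun θ => hcS.integral_hasStrictDerivAt 0 θ
    |>.hasDerivAt
  have hprim : ∀ f : ℝ → ℝ, Continuous f → Function.Periodic f (2 * Real.pi) →
      ∫ x in 0..(2 * Real.pi), f x = 0 →
      Function.Periodic (fun θ => ∫ x in 0..θ, f x) (2 * Real.pi) := by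
    intro f hf hfper hf0 θ
    have h1 := intervalIntegral.integral_add_adjacent_intervals
      (hf.intervalIntegrable (μ := MeasureTheory.volume) 0 θ)
      (hf.intervalIntegrable θ (θ + 2 * Real.pi))
    have h2 := hfper.intervalIntegral_add_eq θ 0
    rw [zero_add, hf0] at h2
    simp only
    rw [← h1, h2, add_zero]
  have hpC : Function.Periodic C (2 * Real.pi) := hprim _ hcC
    (fun x => by simp only [hper x, Real.cos_add_two_pi]) hcos
  have hpS : Function.Periodic S (2 * Real.pi) := hprim _ hcS
    (fun x => by simp only [hper x, Real.sin_add_two_pi]) hsin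
  -- Variation of constants for `h'' + h = ρ` with zero initial data; the closing condition is what
  -- makes `C` and `S`, hence `h`, periodic.
  refine ⟨fun θ => Real.sin θ * C θ - Real.cos θ * S θ,
    fun θ => Real.cos θ * C θ + Real.sin θ * S θ, ⟨fun θ => ?_, fun θ => ?_, fun θ => ?_, hc, hpos⟩,
    ?_, ?_⟩
  · refine (((Real.hasDerivAt_sin θ).mul (hdC θ)).sub
      ((Real.hasDerivAt_cos θ).mul (hdS θ))).congr_deriv ?_
    ring
  · refine (((Real.hasDerivAt_cos θ).mul (hdC θ)).add
      ((Real.hasDerivAt_sin θ).mul (hdS θ))).congr_deriv ?_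
    linear_combination ρ θ * Real.sin_sq_add_cos_sq θ
  · simp only [hpC θ, hpS θ, Real.sin_add_two_pi, Real.cos_add_two_pi]
  · simp [hS]
  · simp [hC]

/-! ### Slices and primitives of functions of two variables -/

theorem ContinuousOn.continuous_slice_fst {f : ℝ → ℝ → ℝ} {J : Set ℝ}
    (hf : ContinuousOn (fun p : ℝ × ℝ => f p.1 p.2) (univ ×ˢ J)) {t : ℝ} (ht : t ∈ J) :
    Continuous fun θ => f θ t :=
  hf.comp_continuous (f := fun θ => (θ, t)) (by fun_prop) fun θ => ⟨mem_univ θ, ht⟩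

theorem ContinuousOn.continuousOn_slice_snd {f : ℝ → ℝ → ℝ} {J : Set ℝ}
    (hf : ContinuousOn (fun p : ℝ × ℝ => f p.1 p.2) (univ ×ˢ J)) (θ : ℝ) :
    ContinuousOn (fun t => f θ t) J :=
  hf.comp (f := fun t => (θ, t)) (by fun_prop) fun _ ht => ⟨mem_univ θ, ht⟩

/-- A primitive in the second variable of a function of two variables is jointly continuous. -/
theorem continuousOn_primitive_snd {g : ℝ → ℝ → ℝ} {J : Set ℝ}
    (hg : ContinuousOn (fun p : ℝ × ℝ => g p.1 p.2) (univ ×ˢ J)) {a b : ℝ} (hJ : Ico a b ⊆ J) :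
    ContinuousOn (fun p : ℝ × ℝ => ∫ s in a..p.2, g p.1 s) (univ ×ˢ Ico a b) := by
  refine continuousOn_of_locally_continuousOn fun p hp => ?_
  obtain ⟨c, hpc, hcb⟩ := exists_between hp.2.2
  have hac : a ≤ c := hp.2.1.trans hpc.le
  refine ⟨univ ×ˢ Iio c, isOpen_univ.prod isOpen_Iio, ⟨mem_univ _, hpc⟩, ?_⟩
  -- Clamping time to `[a, c]` makes the integrand continuous everywhere without changing it where
  -- it is used.
  have hclamp : Continuous fun p : ℝ × ℝ => g p.1 (projIcc a c hac p.2) :=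
    hg.comp_continuous (f := fun p : ℝ × ℝ => (p.1, (projIcc a c hac p.2 : ℝ)))
      (continuous_fst.prodMk (continuous_subtype_val.comp (continuous_projIcc.comp continuous_snd)))
      fun p => ⟨mem_univ _, hJ ⟨(projIcc a c hac p.2).2.1, (projIcc a c hac p.2).2.2.trans_lt hcb⟩⟩
  have hcont : Continuous fun p : ℝ × ℝ => ∫ s in a..p.2, g p.1 (projIcc a c hac s) :=
    intervalIntegral.continuous_parametric_intervalIntegral_of_continuous
      (f := fun (p : ℝ × ℝ) s => g p.1 (projIcc a c hac s))
      (hclamp.comp (f := fun q : (ℝ × ℝ) × ℝ => (q.1.1, q.2)) (by fun_prop)) continuous_snd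
  refine hcont.continuousOn.congr fun q hq => intervalIntegral.integral_congr fun s hs => ?_
  rw [uIcc_of_le hq.1.2.1] at hs
  simp only [projIcc_of_mem hac ⟨hs.1, hs.2.trans hq.2.2.le⟩]

/-! ### Convex curves that move with a given speed -/

/-- The closed convex curves with radius of curvature `ρ`, as a function of the angle of the normal,
move with outward normal speed `S` at the times in `J`; here `S'` and `S''` are the first two
derivatives of `S` with respect to the angle. -/
structure IsNormalSpeed (J : Set ℝ) (ρ S S' S'' : ℝ → ℝ → ℝ) : Prop where
  continuousOn_radius : ContinuousOn (fun p : ℝ × ℝ => ρ p.1 p.2) (univ ×ˢ J)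
  continuousOn : ContinuousOn (fun p : ℝ × ℝ => S p.1 p.2) (univ ×ˢ J)
  continuousOn' : ContinuousOn (fun p : ℝ × ℝ => S' p.1 p.2) (univ ×ˢ J)
  continuousOn'' : ContinuousOn (fun p : ℝ × ℝ => S'' p.1 p.2) (univ ×ˢ J)
  radius_pos : ∀ θ, ∀ t ∈ J, 0 < ρ θ t
  periodic_radius : ∀ t ∈ J, Function.Periodic (fun θ => ρ θ t) (2 * Real.pi)
  periodic : ∀ t ∈ J, Function.Periodic (fun θ => S θ t) (2 * Real.pi)
  hasDerivAt : ∀ θ, ∀ t ∈ J, HasDerivAt (fun φ => S φ t) (S' θ t) θ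
  hasDerivAt' : ∀ θ, ∀ t ∈ J, HasDerivAt (fun φ => S' φ t) (S'' θ t) θ
  hasDerivAt_radius : ∀ θ, ∀ t ∈ J, HasDerivAt (fun s => ρ θ s) (S'' θ t + S θ t) t

namespace IsNormalSpeed

variable {J : Set ℝ} {ρ S S' S'' : ℝ → ℝ → ℝ}

theorem periodic' (H : IsNormalSpeed J ρ S S' S'') {t : ℝ} (ht : t ∈ J) :
    Function.Periodic (fun θ => S' θ t) (2 * Real.pi) := by
  intro θ
  have h1 := (H.hasDerivAt (θ + 2 * Real.pi) t ht).comp_add_const θ (2 * Real.pi)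
  rw [funext (H.periodic t ht)] at h1
  exact h1.unique (H.hasDerivAt θ t ht)

theorem continuousOn_deriv_radius (H : IsNormalSpeed J ρ S S' S'') :
    ContinuousOn (fun p : ℝ × ℝ => S'' p.1 p.2 + S p.1 p.2) (univ ×ˢ J) :=
  H.continuousOn''.add H.continuousOn

/-- The cosine is annihilated by `∂² + 1`, so `(S'' + S) cos` is the derivative of the periodic
function `S' cos + S sin`. Thus the motion preserves closedness. -/
theorem hasDerivAt_integral_radius_mul_cos (H : IsNormalSpeed J ρ S S' S'') (hJ : IsOpen J) {t : ℝ}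
    (ht : t ∈ J) : HasDerivAt (fun s => ∫ θ in 0..(2 * Real.pi), ρ θ s * Real.cos θ) 0 t := by
  have hcos : ContinuousOn (fun p : ℝ × ℝ => Real.cos p.1) (univ ×ˢ J) := by fun_prop
  have h1 := hasDerivAt_intervalIntegral_fst hJ (g := fun θ s => ρ θ s * Real.cos θ)
    (g' := fun θ s => (S'' θ s + S θ s) * Real.cos θ) (H.continuousOn_radius.mul hcos)
    (H.continuousOn_deriv_radius.mul hcos)
    (fun θ s hs => (H.hasDerivAt_radius θ s hs).mul_const _) Real.two_pi_pos.le ht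
  convert h1 using 1
  have := integral_deriv_eq_zero_of_periodic
    (f := fun θ => S' θ t * Real.cos θ + S θ t * Real.sin θ)
    (f' := fun θ => (S'' θ t + S θ t) * Real.cos θ) (c := 2 * Real.pi) (fun θ => ?_) ?_ ?_ 0
  · rw [zero_add] at this
    exact this.symm
  · refine (((H.hasDerivAt' θ t ht).mul (Real.hasDerivAt_cos θ)).add
      ((H.hasDerivAt θ t ht).mul (Real.hasDerivAt_sin θ))).congr_deriv ?_
    ring
  · exact (H.continuousOn_deriv_radius.continuous_slice_fst (f := fun θ s => S'' θ s + S θ s)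
      ht).mul Real.continuous_cos
  · intro θ
    have h2 := H.periodic t ht θ
    have h3 := H.periodic' ht θ
    simp only at h2 h3 ⊢
    rw [h2, h3, Real.cos_add_two_pi, Real.sin_add_two_pi]

theorem hasDerivAt_integral_radius_mul_sin (H : IsNormalSpeed J ρ S S' S'') (hJ : IsOpen J) {t : ℝ}
    (ht : t ∈ J) : HasDerivAt (fun s => ∫ θ in 0..(2 * Real.pi), ρ θ s * Real.sin θ) 0 t := by
  have hsin : ContinuousOn (fun p : ℝ × ℝ => Real.sin p.1) (univ ×ˢ J) := by fun_prop
  have h1 := hasDerivAt_intervalIntegral_fst hJ (g := fun θ s => ρ θ s * Real.sin θ)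
    (g' := fun θ s => (S'' θ s + S θ s) * Real.sin θ) (H.continuousOn_radius.mul hsin)
    (H.continuousOn_deriv_radius.mul hsin)
    (fun θ s hs => (H.hasDerivAt_radius θ s hs).mul_const _) Real.two_pi_pos.le ht
  convert h1 using 1
  have := integral_deriv_eq_zero_of_periodic
    (f := fun θ => S' θ t * Real.sin θ - S θ t * Real.cos θ)
    (f' := fun θ => (S'' θ t + S θ t) * Real.sin θ) (c := 2 * Real.pi) (fun θ => ?_) ?_ ?_ 0
  · rw [zero_add] at this
    exact this.symm
  · refine (((H.hasDerivAt' θ t ht).mul (Real.hasDerivAt_sin θ)).sub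
      ((H.hasDerivAt θ t ht).mul (Real.hasDerivAt_cos θ))).congr_deriv ?_
    ring
  · exact (H.continuousOn_deriv_radius.continuous_slice_fst (f := fun θ s => S'' θ s + S θ s)
      ht).mul Real.continuous_sin
  · intro θ
    have h2 := H.periodic t ht θ
    have h3 := H.periodic' ht θ
    simp only at h2 h3 ⊢
    rw [h2, h3, Real.cos_add_two_pi, Real.sin_add_two_pi]

/-- First variation of the length. -/
theorem hasDerivAt_length (H : IsNormalSpeed J ρ S S' S'') (hJ : IsOpen J) {t : ℝ} (ht : t ∈ J) :
    HasDerivAt (fun s => ∫ θ in 0..(2 * Real.pi), ρ θ s) (∫ θ in 0..(2 * Real.pi), S θ t) t := by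
  have h1 := hasDerivAt_intervalIntegral_fst hJ H.continuousOn_radius
    (g' := fun θ s => S'' θ s + S θ s) H.continuousOn_deriv_radius H.hasDerivAt_radius
    Real.two_pi_pos.le ht
  convert h1 using 1
  have hc := H.continuousOn''.continuous_slice_fst ht
  have := integral_deriv_eq_zero_of_periodic (fun θ => H.hasDerivAt' θ t ht) hc (H.periodic' ht) 0
  rw [zero_add] at this
  rw [intervalIntegral.integral_add (hc.intervalIntegrable _ _)
    ((H.continuousOn.continuous_slice_fst ht).intervalIntegrable _ _), this, zero_add]

end IsNormalSpeed

/-- `h`, with angular derivative `h'`, is a family of support functions of the curves with radius of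
curvature `ρ`, for the times in `[a, b)`, and evolves with the normal speed `S`. -/
structure IsSupportEvolution (a b : ℝ) (h h' ρ S : ℝ → ℝ → ℝ) : Prop where
  support : ∀ t ∈ Ico a b, IsSupportFunction (fun θ => h θ t) (fun θ => h' θ t) (fun θ => ρ θ t)
  continuousOn : ContinuousOn (fun p : ℝ × ℝ => h p.1 p.2) (univ ×ˢ Ico a b)
  hasDerivAt_time : ∀ θ, ∀ t ∈ Ioo a b, HasDerivAt (fun s => h θ s) (S θ t) t

/-- A support function at the initial time extends to a family of support functions. -/
theorem IsNormalSpeed.exists_isSupportEvolution {J : Set ℝ} {ρ S S' S'' : ℝ → ℝ → ℝ}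
    (H : IsNormalSpeed J ρ S S' S'') (hJ : IsOpen J) {a b : ℝ} (hab : Ico a b ⊆ J)
    {h₀ h₀' : ℝ → ℝ} (H₀ : IsSupportFunction h₀ h₀' (fun θ => ρ θ a)) :
    ∃ h h' : ℝ → ℝ → ℝ, IsSupportEvolution a b h h' ρ S ∧ ∀ θ, h θ a = h₀ θ := by
  have hIcc : ∀ t ∈ Ico a b, Icc a t ⊆ J := fun t ht => (Icc_subset_Ico_right ht.2).trans hab
  have hint : ∀ f : ℝ → ℝ → ℝ, ContinuousOn (fun p : ℝ × ℝ => f p.1 p.2) (univ ×ˢ J) →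
      ∀ θ, ∀ t ∈ Ico a b, IntervalIntegrable (fun s => f θ s) MeasureTheory.volume a t := by
    intro f hf θ t ht
    refine ((hf.continuousOn_slice_snd θ).mono ?_).intervalIntegrable
    rw [uIcc_of_le ht.1]
    exact hIcc t ht
  have hparam : ∀ f f' : ℝ → ℝ → ℝ, ContinuousOn (fun p : ℝ × ℝ => f p.1 p.2) (univ ×ˢ J) →
      ContinuousOn (fun p : ℝ × ℝ => f' p.1 p.2) (univ ×ˢ J) →
      (∀ θ, ∀ t ∈ J, HasDerivAt (fun φ => f φ t) (f' θ t) θ) → ∀ θ, ∀ t ∈ Ico a b,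
      HasDerivAt (fun φ => ∫ s in a..t, f φ s) (∫ s in a..t, f' θ s) θ :=
    fun f f' hf hf' hd θ t ht =>
      have hsub := prod_mono (Subset.refl (univ : Set ℝ)) (hIcc t ht)
      hasDerivAt_intervalIntegral_of_continuousOn isOpen_univ ht.1 (hf.mono hsub) (hf'.mono hsub)
        (fun φ _ s hs => hd φ s (hIcc t ht hs)) (mem_univ θ)
  refine ⟨fun θ t => h₀ θ + ∫ s in a..t, S θ s, fun θ t => h₀' θ + ∫ s in a..t, S' θ s,
    ⟨fun t ht => ⟨fun θ => ?_, fun θ => ?_, fun θ => ?_, ?_, ?_⟩, ?_, fun θ t ht => ?_⟩,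
    fun θ => by simp⟩
  · exact (H₀.hasDerivAt θ).add (hparam S S' H.continuousOn H.continuousOn' H.hasDerivAt θ t ht)
  · refine ((H₀.hasDerivAt' θ).add
      (hparam S' S'' H.continuousOn' H.continuousOn'' H.hasDerivAt' θ t ht)).congr_deriv ?_
    -- Integrating `ρ_t = S'' + S` in time carries the relation `h'' + h = ρ` from time `a` to time
    -- `t`.
    have h1 : ∫ s in a..t, (S'' θ s + S θ s) = ρ θ t - ρ θ a :=
      intervalIntegral.integral_eq_sub_of_hasDerivAt (fun s hs => by
        rw [uIcc_of_le ht.1] at hs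
        exact H.hasDerivAt_radius θ s (hIcc t ht hs))
        (hint (fun θ s => S'' θ s + S θ s) H.continuousOn_deriv_radius θ t ht)
    rw [intervalIntegral.integral_add (hint S'' H.continuousOn'' θ t ht)
      (hint S H.continuousOn θ t ht)] at h1
    linarith
  · have h1 : ∫ s in a..t, S (θ + 2 * Real.pi) s = ∫ s in a..t, S θ s :=
      intervalIntegral.integral_congr fun s hs => by
        rw [uIcc_of_le ht.1] at hs
        exact H.periodic s (hIcc t ht hs) θ
    simp only [H₀.periodic θ, h1]
  · exact H.continuousOn_radius.continuous_slice_fst (hab ht)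
  · exact fun θ => H.radius_pos θ t (hab ht)
  · exact (H₀.continuous_self.comp continuous_fst).continuousOn.add
      (continuousOn_primitive_snd H.continuousOn hab)
  · have htJ : t ∈ J := hab ⟨ht.1.le, ht.2⟩
    have hc := H.continuousOn.continuousOn_slice_snd θ
    exact (intervalIntegral.integral_hasDerivAt_right (hint S H.continuousOn θ t ⟨ht.1.le, ht.2⟩)
      (hc.stronglyMeasurableAtFilter hJ t htJ) (hc.continuousAt (hJ.mem_nhds htJ))).const_add _

namespace IsSupportEvolution

variable {a b : ℝ} {h h' ρ S : ℝ → ℝ → ℝ}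

theorem mono_left (E : IsSupportEvolution a b h h' ρ S) {c : ℝ} (hc : a ≤ c) :
    IsSupportEvolution c b h h' ρ S where
  support t ht := E.support t (Ico_subset_Ico_left hc ht)
  continuousOn := E.continuousOn.mono (prod_mono Subset.rfl (Ico_subset_Ico_left hc))
  hasDerivAt_time θ t ht := E.hasDerivAt_time θ t (Ioo_subset_Ioo_left hc ht)

/-- Change of the origin. -/
theorem sub_center (E : IsSupportEvolution a b h h' ρ S) (x y : ℝ) :
    IsSupportEvolution a b (fun θ t => h θ t - x * Real.cos θ - y * Real.sin θ)
      (fun θ t => h' θ t + x * Real.sin θ - y * Real.cos θ) ρ S where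
  support t ht :=
    { hasDerivAt := fun θ => by
        refine ((((E.support t ht).hasDerivAt θ).sub ((Real.hasDerivAt_cos θ).const_mul x)).sub
          ((Real.hasDerivAt_sin θ).const_mul y)).congr_deriv ?_
        ring
      hasDerivAt' := fun θ => by
        refine ((((E.support t ht).hasDerivAt' θ).add ((Real.hasDerivAt_sin θ).const_mul x)).sub
          ((Real.hasDerivAt_cos θ).const_mul y)).congr_deriv ?_
        ring
      periodic := fun θ => by
        have := (E.support t ht).periodic θ
        simp only at this ⊢
        rw [this, Real.cos_add_two_pi, Real.sin_add_two_pi]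
      continuous := (E.support t ht).continuous
      pos := (E.support t ht).pos }
  continuousOn := (E.continuousOn.sub (by fun_prop)).sub (by fun_prop)
  hasDerivAt_time θ t ht := ((E.hasDerivAt_time θ t ht).sub_const _).sub_const _

/-- First variation of the area. -/
theorem hasDerivAt_integral_mul_radius (E : IsSupportEvolution a b h h' ρ S) {J : Set ℝ}
    {S' S'' : ℝ → ℝ → ℝ} (H : IsNormalSpeed J ρ S S' S'') (hab : Ico a b ⊆ J) {t : ℝ}
    (ht : t ∈ Ioo a b) :
    HasDerivAt (fun s => ∫ θ in 0..(2 * Real.pi), h θ s * ρ θ s)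
      (2 * ∫ θ in 0..(2 * Real.pi), S θ t * ρ θ t) t := by
  have hIoo : Ioo a b ⊆ J := Ioo_subset_Ico_self.trans hab
  have hsub : (univ : Set ℝ) ×ˢ Ioo a b ⊆ univ ×ˢ J := prod_mono Subset.rfl hIoo
  have hh := E.continuousOn.mono (prod_mono (Subset.refl (univ : Set ℝ)) Ioo_subset_Ico_self)
  have h1 := hasDerivAt_intervalIntegral_fst isOpen_Ioo (g := fun θ s => h θ s * ρ θ s)
    (g' := fun θ s => S θ s * ρ θ s + h θ s * (S'' θ s + S θ s))
    (hh.mul (H.continuousOn_radius.mono hsub))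
    (((H.continuousOn.mono hsub).mul (H.continuousOn_radius.mono hsub)).add
      (hh.mul (H.continuousOn_deriv_radius.mono hsub)))
    (fun θ s hs => (E.hasDerivAt_time θ s hs).mul (H.hasDerivAt_radius θ s (hIoo hs)))
    Real.two_pi_pos.le ht
  convert h1 using 1
  have htJ := hIoo ht
  have Ht := E.support t (Ioo_subset_Ico_self ht)
  have c1 := H.continuousOn.continuous_slice_fst htJ
  have c2 := H.continuousOn''.continuous_slice_fst htJ
  have c3 := Ht.continuous_self
  have c4 := Ht.continuous
  -- Symmetry of `∂² + 1`: the integrals of `h (S'' + S)` and `S ρ` agree, so both terms of the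
  -- product rule contribute equally. This is the factor 2; the integral of `h ρ` is twice the area.
  have hzero := integral_deriv_eq_zero_of_periodic
    (f := fun θ => h θ t * S' θ t - h' θ t * S θ t)
    (f' := fun θ => h θ t * (S'' θ t + S θ t) - S θ t * ρ θ t) (c := 2 * Real.pi)
    (fun θ => ?_) ?_ ?_ 0
  · rw [zero_add, intervalIntegral.integral_sub (Continuous.intervalIntegrable (by fun_prop) _ _)
      (Continuous.intervalIntegrable (by fun_prop) _ _)] at hzero
    rw [intervalIntegral.integral_add (Continuous.intervalIntegrable (by fun_prop) _ _)
      (Continuous.intervalIntegrable (by fun_prop) _ _)]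
    linarith
  · refine (((Ht.hasDerivAt θ).mul (H.hasDerivAt' θ t htJ)).sub
      ((Ht.hasDerivAt' θ).mul (H.hasDerivAt θ t htJ))).congr_deriv ?_
    ring
  · fun_prop
  · intro θ
    have e1 := H.periodic t htJ θ
    have e2 := H.periodic' htJ θ
    have e3 := Ht.periodic θ
    have e4 := Ht.periodic_deriv θ
    simp only at e1 e2 e3 e4 ⊢
    rw [e1, e2, e3, e4]

end IsSupportEvolution

/-! ### The curvature flow -/

namespace IsCurvatureFlowSolution

variable {T : ℝ} {κ : ℝ → ℝ → ℝ}

/-- A solution that is positive at the initial time stays positive. -/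
theorem pos (hκ : IsCurvatureFlowSolution T κ) (hpos : ∀ θ, 0 < κ θ 0) :
    ∀ θ, ∀ t ∈ Ico 0 T, 0 < κ θ t := by
  intro θ t ht
  by_contra! hle
  have hc := (hκ.continuousOn.continuousOn_slice_snd θ).mono (Icc_subset_Ico_right ht.2)
  obtain ⟨s, hs, hs0⟩ := intermediate_value_Icc' ht.1 hc ⟨hle, (hpos θ).le⟩
  exact hκ.ne_zero θ s ⟨hs.1, hs.2.trans_lt ht.2⟩ hs0

theorem continuousOn_inv (hκ : IsCurvatureFlowSolution T κ) :
    ContinuousOn (fun p : ℝ × ℝ => (κ p.1 p.2)⁻¹) (univ ×ˢ Ico 0 T) :=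
  hκ.continuousOn.inv₀ fun p hp => hκ.ne_zero p.1 p.2 hp.2

theorem integral_inv_sq_pos (hκ : IsCurvatureFlowSolution T κ) {t : ℝ} (ht : t ∈ Ico 0 T) :
    0 < ∫ θ in (0 : ℝ)..(2 * Real.pi), 1 / κ θ t ^ 2 := by
  have hc : Continuous fun θ => 1 / κ θ t ^ 2 := continuous_const.div
    ((hκ.continuousOn.continuous_slice_fst ht).pow 2) fun θ => pow_ne_zero 2 (hκ.ne_zero θ t ht)
  refine intervalIntegral.intervalIntegral_pos_of_pos (hc.intervalIntegrable _ _) (fun θ => ?_)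
    Real.two_pi_pos
  have := hκ.ne_zero θ t ht
  positivity

theorem nonlocalTerm_pos (hκ : IsCurvatureFlowSolution T κ) {t : ℝ} (ht : t ∈ Ico 0 T) :
    0 < nonlocalTerm (fun θ => κ θ t) :=
  div_pos Real.two_pi_pos (hκ.integral_inv_sq_pos ht)

theorem continuousOn_nonlocalTerm (hκ : IsCurvatureFlowSolution T κ) :
    ContinuousOn (fun t => nonlocalTerm (fun θ => κ θ t)) (Ico 0 T) := by
  refine continuousOn_const.div (continuousOn_intervalIntegral_fst
    (g := fun θ t => 1 / κ θ t ^ 2) ?_ _ _) fun t ht => (hκ.integral_inv_sq_pos ht).ne'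
  exact continuousOn_const.div (hκ.continuousOn.pow 2)
    fun p hp => pow_ne_zero 2 (hκ.ne_zero p.1 p.2 hp.2)

theorem hasDerivAt_angle (hκ : IsCurvatureFlowSolution T κ) {t : ℝ} (ht : t ∈ Ioo 0 T) (θ : ℝ) :
    HasDerivAt (fun φ => κ φ t) (deriv (fun φ => κ φ t) θ) θ :=
  ((hκ.contDiff_angle t ht).differentiable (by norm_num) θ).hasDerivAt

theorem hasDerivAt_angle_two (hκ : IsCurvatureFlowSolution T κ) {t : ℝ} (ht : t ∈ Ioo 0 T)
    (θ : ℝ) :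
    HasDerivAt (fun φ => deriv (fun φ => κ φ t) φ) (iteratedDeriv 2 (fun φ => κ φ t) θ) θ := by
  have h1 := (hκ.contDiff_angle t ht).differentiable_iteratedDeriv 1 (by norm_num) θ
  rw [iteratedDeriv_one] at h1
  have h2 := h1.hasDerivAt
  rwa [← iteratedDeriv_one, ← iteratedDeriv_succ, iteratedDeriv_one] at h2

theorem hasDerivAt_time (hκ : IsCurvatureFlowSolution T κ) {t : ℝ} (ht : t ∈ Ioo 0 T) (θ : ℝ) :
    HasDerivAt (fun s => κ θ s) (deriv (fun s => κ θ s) t) t :=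
  (hκ.differentiableAt_time θ t ht).hasDerivAt

/-- The curves move with outward normal speed `λ / κ - κ`. -/
theorem exists_isNormalSpeed (hκ : IsCurvatureFlowSolution T κ) (hpos : ∀ θ, 0 < κ θ 0) :
    ∃ S' S'' : ℝ → ℝ → ℝ, IsNormalSpeed (Ioo 0 T) (fun θ t => (κ θ t)⁻¹)
      (fun θ t => nonlocalTerm (fun φ => κ φ t) * (κ θ t)⁻¹ - κ θ t) S' S'' := by
  have hsub : (univ : Set ℝ) ×ˢ Ioo 0 T ⊆ univ ×ˢ Ico 0 T :=
    prod_mono Subset.rfl Ioo_subset_Ico_self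
  have hne : ∀ θ, ∀ t ∈ Ioo 0 T, κ θ t ≠ 0 := fun θ t ht =>
    hκ.ne_zero θ t (Ioo_subset_Ico_self ht)
  have c0 := hκ.continuousOn.mono hsub
  have cinv := hκ.continuousOn_inv.mono hsub
  have c1 := hκ.continuousOn_deriv_angle
  have c2 := hκ.continuousOn_deriv_angle_two
  have clam : ContinuousOn (fun p : ℝ × ℝ => nonlocalTerm (fun φ => κ φ p.2)) (univ ×ˢ Ioo 0 T) :=
    hκ.continuousOn_nonlocalTerm.comp continuousOn_snd fun p hp => Ioo_subset_Ico_self hp.2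
  have hdinv : ∀ θ, ∀ t ∈ Ioo 0 T, HasDerivAt (fun φ => (κ φ t)⁻¹)
      (-deriv (fun φ => κ φ t) θ / κ θ t ^ 2) θ := fun θ t ht =>
    (hκ.hasDerivAt_angle ht θ).inv (hne θ t ht)
  have hper : ∀ t ∈ Ioo 0 T, Function.Periodic (fun θ => κ θ t) (2 * Real.pi) := fun t ht =>
    hκ.periodic t (Ioo_subset_Ico_self ht)
  refine ⟨fun θ t => nonlocalTerm (fun φ => κ φ t) *
      (-deriv (fun φ => κ φ t) θ * (κ θ t)⁻¹ ^ 2) - deriv (fun φ => κ φ t) θ,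
    fun θ t => nonlocalTerm (fun φ => κ φ t) *
      (2 * deriv (fun φ => κ φ t) θ ^ 2 * (κ θ t)⁻¹ ^ 3 -
        iteratedDeriv 2 (fun φ => κ φ t) θ * (κ θ t)⁻¹ ^ 2) - iteratedDeriv 2 (fun φ => κ φ t) θ,
    cinv, (clam.mul cinv).sub c0, (clam.mul (c1.neg.mul (cinv.pow 2))).sub c1,
    (clam.mul (((continuousOn_const.mul (c1.pow 2)).mul (cinv.pow 3)).sub
      (c2.mul (cinv.pow 2)))).sub c2,
    fun θ t ht => inv_pos.2 (hκ.pos hpos θ t (Ioo_subset_Ico_self ht)), fun t ht θ => ?_,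
    fun t ht θ => ?_, fun θ t ht => ?_, fun θ t ht => ?_, fun θ t ht => ?_⟩
  · exact congrArg (·⁻¹) (hper t ht θ)
  · exact congrArg (fun k => nonlocalTerm (fun φ => κ φ t) * k⁻¹ - k) (hper t ht θ)
  · refine (((hdinv θ t ht).const_mul _).sub (hκ.hasDerivAt_angle ht θ)).congr_deriv ?_
    rw [inv_pow, div_eq_mul_inv]
  · refine ((((hκ.hasDerivAt_angle_two ht θ).neg.mul ((hdinv θ t ht).pow 2)).const_mul _).sub
      (hκ.hasDerivAt_angle_two ht θ)).congr_deriv ?_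
    have := hne θ t ht
    simp only [Pi.neg_apply, Pi.pow_apply, Nat.add_one_sub_one, pow_one, Nat.cast_ofNat]
    field_simp
    ring
  -- The curvature equation divided by `-κ²` is exactly `ρ_t = S'' + S`.
  · refine ((hκ.hasDerivAt_time ht θ).inv (hne θ t ht)).congr_deriv ?_
    rw [hκ.equation θ t ht]
    have := hne θ t ht
    field_simp
    ring

/-! ### Monotonicity of area and length -/

/-- The flow preserves the enclosed area. -/
theorem integral_speed_mul_radius (hκ : IsCurvatureFlowSolution T κ) {t : ℝ} (ht : t ∈ Ico 0 T) :
    ∫ θ in 0..(2 * Real.pi), (nonlocalTerm (fun φ => κ φ t) * (κ θ t)⁻¹ - κ θ t) * (κ θ t)⁻¹ =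
      0 := by
  have hpos := hκ.integral_inv_sq_pos ht
  have hc := hκ.continuousOn_inv.continuous_slice_fst (f := fun θ t => (κ θ t)⁻¹) ht
  have h1 : ∀ θ, (nonlocalTerm (fun φ => κ φ t) * (κ θ t)⁻¹ - κ θ t) * (κ θ t)⁻¹ =
      nonlocalTerm (fun φ => κ φ t) * (κ θ t)⁻¹ ^ 2 - 1 := by
    intro θ
    have := hκ.ne_zero θ t ht
    field_simp
  have h2 : ∫ θ in 0..(2 * Real.pi), (κ θ t)⁻¹ ^ 2 = ∫ θ in 0..(2 * Real.pi), 1 / κ θ t ^ 2 := by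
    simp only [inv_pow, one_div]
  simp only [h1]
  rw [intervalIntegral.integral_sub (Continuous.intervalIntegrable (by fun_prop) _ _)
    (by simp), intervalIntegral.integral_const_mul, h2, nonlocalTerm, div_mul_cancel₀ _ hpos.ne']
  simp

/-- The flow does not increase the length. -/
theorem integral_speed_nonpos (hκ : IsCurvatureFlowSolution T κ) (hpos : ∀ θ, 0 < κ θ 0) {t : ℝ}
    (ht : t ∈ Ico 0 T) :
    ∫ θ in 0..(2 * Real.pi), (nonlocalTerm (fun φ => κ φ t) * (κ θ t)⁻¹ - κ θ t) ≤ 0 := by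
  have hk := fun θ => hκ.pos hpos θ t ht
  have cinv := hκ.continuousOn_inv.continuous_slice_fst (f := fun θ t => (κ θ t)⁻¹) ht
  have c0 := hκ.continuousOn.continuous_slice_fst ht
  have hQ := hκ.integral_inv_sq_pos ht
  set Q := ∫ θ in (0 : ℝ)..(2 * Real.pi), 1 / κ θ t ^ 2 with hQdef
  set L := ∫ θ in 0..(2 * Real.pi), (κ θ t)⁻¹ with hL
  have hLpos : 0 < L := intervalIntegral.intervalIntegral_pos_of_pos
    (cinv.intervalIntegrable _ _) (fun θ => inv_pos.2 (hk θ)) Real.two_pi_pos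
  have hπ := Real.pi_pos
  have hQ' : ∫ θ in 0..(2 * Real.pi), (κ θ t)⁻¹ ^ 2 = Q := by
    simp only [hQdef, inv_pow, one_div]
  -- The two Cauchy-Schwarz bounds, `∫ κ ≥ 4π²/L` here and `∫ ρ² ≥ L²/(2π)` in `hsq`, come from
  -- tangent-line inequalities at the mean radius `L/(2π)`. Together they give `λ L ≤ 4π²/L ≤ ∫ κ`.
  have hlow : ∫ θ in 0..(2 * Real.pi), (2 * (2 * Real.pi / L) - (2 * Real.pi / L) ^ 2 * (κ θ t)⁻¹) ≤
      ∫ θ in 0..(2 * Real.pi), κ θ t := by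
    refine intervalIntegral.integral_mono_on Real.two_pi_pos.le
      (Continuous.intervalIntegrable (by fun_prop) _ _) (c0.intervalIntegrable _ _) fun θ _ => ?_
    have h1 : κ θ t - (2 * (2 * Real.pi / L) - (2 * Real.pi / L) ^ 2 * (κ θ t)⁻¹) =
        (κ θ t)⁻¹ * (κ θ t - 2 * Real.pi / L) ^ 2 := by
      have := (hk θ).ne'
      field_simp
      ring
    have h2 : 0 ≤ (κ θ t)⁻¹ * (κ θ t - 2 * Real.pi / L) ^ 2 :=
      mul_nonneg (inv_pos.2 (hk θ)).le (sq_nonneg _)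
    linarith
  have hsq : ∫ θ in 0..(2 * Real.pi), (2 * (L / (2 * Real.pi)) * (κ θ t)⁻¹ -
      (L / (2 * Real.pi)) ^ 2) ≤ ∫ θ in 0..(2 * Real.pi), (κ θ t)⁻¹ ^ 2 := by
    refine intervalIntegral.integral_mono_on Real.two_pi_pos.le
      (Continuous.intervalIntegrable (by fun_prop) _ _)
      (Continuous.intervalIntegrable (by fun_prop) _ _) fun θ _ => ?_
    nlinarith [sq_nonneg ((κ θ t)⁻¹ - L / (2 * Real.pi))]
  rw [intervalIntegral.integral_sub (by simp)
    (Continuous.intervalIntegrable (by fun_prop) _ _),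
    intervalIntegral.integral_const_mul ((2 * Real.pi / L) ^ 2),
    intervalIntegral.integral_const, ← hL, smul_eq_mul, sub_zero] at hlow
  rw [intervalIntegral.integral_sub (Continuous.intervalIntegrable (by fun_prop) _ _) (by simp),
    intervalIntegral.integral_const_mul, intervalIntegral.integral_const, ← hL, smul_eq_mul,
    sub_zero, hQ'] at hsq
  rw [intervalIntegral.integral_sub (Continuous.intervalIntegrable (by fun_prop) _ _)
    (c0.intervalIntegrable _ _), intervalIntegral.integral_const_mul, nonlocalTerm, ← hL, ← hQdef]
  have e1 : 2 * Real.pi * (2 * (2 * Real.pi / L)) - (2 * Real.pi / L) ^ 2 * L =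
      4 * Real.pi ^ 2 / L := by
    field_simp
    ring
  have e2 : 2 * (L / (2 * Real.pi)) * L - 2 * Real.pi * (L / (2 * Real.pi)) ^ 2 =
      L ^ 2 / (2 * Real.pi) := by
    field_simp
    ring
  rw [e1] at hlow
  rw [e2] at hsq
  have h3 : 2 * Real.pi / Q * L ≤ 4 * Real.pi ^ 2 / L := by
    rw [div_le_iff₀ (by positivity)] at hsq
    rw [div_mul_eq_mul_div, div_le_div_iff₀ hQ hLpos]
    nlinarith
  linarith

/-! ### Estimates by the maximum principle -/

/-- A disc inside the curve at some time stays inside for a time controlled by its radius. -/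
theorem half_lt_support (hκ : IsCurvatureFlowSolution T κ) {a r : ℝ} (ha : 0 ≤ a) (hr : 0 < r)
    (haT : T - a ≤ r ^ 2 / 8) {h h' : ℝ → ℝ → ℝ}
    (E : IsSupportEvolution a T h h' (fun θ t => (κ θ t)⁻¹)
      (fun θ t => nonlocalTerm (fun φ => κ φ t) * (κ θ t)⁻¹ - κ θ t))
    (hinit : ∀ θ, r ≤ h θ a) : ∀ θ, ∀ t ∈ Ico a T, r / 2 < h θ t := by
  have hbar : ∀ t ∈ Ico a T, 2 / r * (t - a) ≤ r / 4 := by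
    intro t ht
    rw [div_mul_eq_mul_div, div_le_iff₀ hr]
    nlinarith [ht.2]
  -- The barrier radius starts at `3r/4`, strictly below `r`, and shrinks at speed `2/r`; by `hbar`
  -- it stays at least `r/2`. At a first contact `ρ ≥ h ≥ r/2`, so `κ ≤ 2/r`, and the positive term
  -- `λρ` makes the curve move inward strictly slower than the barrier.
  have key := neg_of_deriv_neg_at_spatial_max
    (f := fun θ t => 3 * r / 4 - 2 / r * (t - a) - h θ t)
    (f' := fun θ t => -(2 / r) - (nonlocalTerm (fun φ => κ φ t) * (κ θ t)⁻¹ - κ θ t))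
    (a := a) (b := T) Real.two_pi_pos ?_ ?_ ?_ ?_ ?_
  · intro θ t ht
    have h1 := key θ t ht
    have h2 := hbar t ht
    linarith
  · exact ContinuousOn.sub (by fun_prop) E.continuousOn
  · intro t ht θ
    have := (E.support t ht).periodic θ
    simp only at this ⊢
    rw [this]
  · intro θ t ht
    refine HasDerivAt.sub ?_ (E.hasDerivAt_time θ t ht)
    refine (((((hasDerivAt_id t).sub_const a).const_mul (2 / r)).const_sub (3 * r / 4))).congr_deriv
      ?_
    ring
  · intro θ
    linarith [hinit θ]
  · intro θ t ht hz hmax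
    have ht' : t ∈ Ico a T := Ioo_subset_Ico_self ht
    have H := E.support t ht'
    have h2 := second_deriv_nonpos_of_forall_le (x := θ)
      (fun φ => (H.hasDerivAt φ).const_sub (3 * r / 4 - 2 / r * (t - a)))
      (H.hasDerivAt' θ).neg (fun φ => by rw [hz]; exact hmax φ)
    have h3 := hbar t ht'
    have hρ : r / 2 ≤ (κ θ t)⁻¹ := by linarith
    have hk : κ θ t ≤ 2 / r := by
      have := inv_anti₀ (by positivity) hρ
      rwa [inv_inv, inv_div] at this
    have hlam := mul_pos (hκ.nonlocalTerm_pos ⟨ha.trans ht'.1, ht'.2⟩) (H.pos θ)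
    linarith

/-- As long as a fixed disc stays inside the curve, the curvature is controlled by the support
function with respect to the center of the disc. -/
theorem exists_le_mul_support (hκ : IsCurvatureFlowSolution T κ) (hpos : ∀ θ, 0 < κ θ 0) {a r : ℝ}
    (ha : 0 ≤ a) (haT : a < T) (hr : 0 < r) {h h' : ℝ → ℝ → ℝ}
    (E : IsSupportEvolution a T h h' (fun θ t => (κ θ t)⁻¹)
      (fun θ t => nonlocalTerm (fun φ => κ φ t) * (κ θ t)⁻¹ - κ θ t))
    (hdisc : ∀ θ, ∀ t ∈ Ico a T, 2 * r ≤ h θ t) :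
    ∃ M : ℝ, 0 < M ∧ ∀ θ, ∀ t ∈ Ico a T, κ θ t ≤ M * h θ t := by
  have hIco : Ico a T ⊆ Ico 0 T := Ico_subset_Ico_left ha
  have haI : a ∈ Ico a T := ⟨le_rfl, haT⟩
  obtain ⟨B, hB⟩ := isCompact_Icc.exists_bound_of_continuousOn (s := Icc 0 (2 * Real.pi))
    (hκ.continuousOn.continuous_slice_fst (hIco haI)).continuousOn
  have hB' : ∀ θ, κ θ a ≤ B := by
    intro θ
    obtain ⟨φ, hφ, heq⟩ := (hκ.periodic a (hIco haI)).exists_mem_Ico₀ Real.two_pi_pos θ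
    rw [heq]
    exact (le_abs_self _).trans (hB φ (Ico_subset_Icc_self hφ))
  have hB0 : 0 < B := (hκ.pos hpos 0 a (hIco haI)).trans_le (hB' 0)
  -- The summand `B / r` secures the initial inequality, `2 / r ^ 2` secures `κ r > 2` at a contact,
  -- where `κ = M (h - r) ≥ M r`, and `1` makes both strict.
  obtain ⟨M, hM⟩ : ∃ M, M = B / r + 2 / r ^ 2 + 1 := ⟨_, rfl⟩
  have hM0 : 0 < M := by rw [hM]; positivity
  have hMB : B < M * r := by
    have : M * r = B + 2 / r + r := by
      rw [hM]
      field_simp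
    have h2 : 0 < 2 / r := by positivity
    linarith
  have hMr : 2 < M * r * r := by
    have : M * r * r = B * r + 2 + r ^ 2 := by
      rw [hM]
      field_simp
    have h2 : 0 < B * r := by positivity
    have h3 : 0 < r ^ 2 := by positivity
    linarith
  refine ⟨M, hM0, ?_⟩
  have key := neg_of_deriv_neg_at_spatial_max (f := fun θ t => κ θ t - M * (h θ t - r))
    (f' := fun θ t => deriv (fun s => κ θ s) t -
      M * (nonlocalTerm (fun φ => κ φ t) * (κ θ t)⁻¹ - κ θ t))
    (a := a) (b := T) Real.two_pi_pos ?_ ?_ ?_ ?_ ?_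
  · intro θ t ht
    have h1 := key θ t ht
    nlinarith
  · exact (hκ.continuousOn.mono (prod_mono Subset.rfl hIco)).sub
      (continuousOn_const.mul (E.continuousOn.sub continuousOn_const))
  · intro t ht θ
    have h1 := (E.support t ht).periodic θ
    have h2 := hκ.periodic t (hIco ht) θ
    simp only at h1 h2 ⊢
    rw [h1, h2]
  · intro θ t ht
    exact (hκ.hasDerivAt_time ⟨ha.trans_lt ht.1, ht.2⟩ θ).sub
      (((E.hasDerivAt_time θ t ht).sub_const r).const_mul M)
  · intro θ
    have h1 := hdisc θ a haI
    nlinarith [hB' θ]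
  · intro θ t ht hz hmax
    have ht' : t ∈ Ico a T := Ioo_subset_Ico_self ht
    have htT : t ∈ Ioo 0 T := ⟨ha.trans_lt ht.1, ht.2⟩
    have H := E.support t ht'
    have h2 := second_deriv_nonpos_of_forall_le (x := θ)
      (fun φ => (hκ.hasDerivAt_angle htT φ).sub (((H.hasDerivAt φ).sub_const r).const_mul M))
      ((hκ.hasDerivAt_angle_two htT θ).sub ((H.hasDerivAt' θ).const_mul M))
      (fun φ => by
        have := hmax φ
        rw [← hz] at this
        exact this)
    have hk : 0 < κ θ t := hκ.pos hpos θ t (hIco ht')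
    have hlam := hκ.nonlocalTerm_pos (hIco ht')
    have hu := hdisc θ t ht'
    rw [hκ.equation θ t htT]
    set lam := nonlocalTerm fun φ => κ φ t
    set k := κ θ t
    -- With `h_θθ = k⁻¹ - h` and `M h = k + M r`, the terms `M lam / k` and `k ^ 3` cancel. What
    -- remains is at most `-M k (k r - 2) - 2 lam k - lam M r`, which is negative.
    have h3 : (k ^ 2 + lam) * iteratedDeriv 2 (fun φ => κ φ t) θ ≤
        (k ^ 2 + lam) * (M * (k⁻¹ - h θ t)) :=
      mul_le_mul_of_nonneg_left (by linarith) (by positivity)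
    have h4 : 0 ≤ 2 * lam / k * deriv (fun φ => κ φ t) θ ^ 2 := by positivity
    have hMh : M * h θ t = k + M * r := by linarith
    have h5 : (k ^ 2 + lam) * (M * (k⁻¹ - h θ t)) =
        M * k + M * lam * k⁻¹ - (k ^ 2 + lam) * (k + M * r) := by
      rw [← hMh]
      field_simp
    have hkr : 2 < k * r := by
      have : M * r ≤ k := by nlinarith
      nlinarith
    have h6 : 0 < M * k * (k * r - 2) := mul_pos (mul_pos hM0 hk) (by linarith)
    have h7 : 0 < lam * (M * r) := by positivity
    have h8 : 0 < lam * k := by positivity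
    rw [h5] at h3
    linarith

/-! ### Closedness along the flow and bounds before the final time -/

/-- The curves stay closed. -/
theorem integral_inv_mul_cos_eq (hκ : IsCurvatureFlowSolution T κ) (hpos : ∀ θ, 0 < κ θ 0) {t : ℝ}
    (ht : t ∈ Ico 0 T) :
    ∫ θ in 0..(2 * Real.pi), (κ θ t)⁻¹ * Real.cos θ =
      ∫ θ in 0..(2 * Real.pi), (κ θ 0)⁻¹ * Real.cos θ := by
  obtain ⟨S', S'', H⟩ := hκ.exists_isNormalSpeed hpos
  -- Derivatives exist only at positive times; continuity at time `0` connects the conserved value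
  -- to the initial curve.
  refine eq_of_hasDerivAt_zero ht.1
    ((continuousOn_intervalIntegral_fst (g := fun θ s => (κ θ s)⁻¹ * Real.cos θ)
      (hκ.continuousOn_inv.mul (by fun_prop)) _ _).mono (Icc_subset_Ico_right ht.2))
    (fun s hs => H.hasDerivAt_integral_radius_mul_cos isOpen_Ioo ⟨hs.1, hs.2.trans ht.2⟩)
    fun _ _ => rfl

/-- The curves stay closed. -/
theorem integral_inv_mul_sin_eq (hκ : IsCurvatureFlowSolution T κ) (hpos : ∀ θ, 0 < κ θ 0) {t : ℝ}
    (ht : t ∈ Ico 0 T) :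
    ∫ θ in 0..(2 * Real.pi), (κ θ t)⁻¹ * Real.sin θ =
      ∫ θ in 0..(2 * Real.pi), (κ θ 0)⁻¹ * Real.sin θ := by
  obtain ⟨S', S'', H⟩ := hκ.exists_isNormalSpeed hpos
  refine eq_of_hasDerivAt_zero ht.1
    ((continuousOn_intervalIntegral_fst (g := fun θ s => (κ θ s)⁻¹ * Real.sin θ)
      (hκ.continuousOn_inv.mul (by fun_prop)) _ _).mono (Icc_subset_Ico_right ht.2))
    (fun s hs => H.hasDerivAt_integral_radius_mul_sin isOpen_Ioo ⟨hs.1, hs.2.trans ht.2⟩)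
    fun _ _ => rfl

/-- A solution is bounded up to every time before the final one. -/
theorem exists_bound_Icc (hκ : IsCurvatureFlowSolution T κ) {a : ℝ} (haT : a < T) :
    ∃ C, ∀ θ, ∀ t ∈ Icc 0 a, |κ θ t| ≤ C := by
  obtain ⟨C, hC⟩ := ((isCompact_Icc (a := (0 : ℝ)) (b := 2 * Real.pi)).prod
    (isCompact_Icc (a := 0) (b := a))).exists_bound_of_continuousOn
    (hκ.continuousOn.mono (prod_mono (subset_univ _) (Icc_subset_Ico_right haT)))
  refine ⟨C, fun θ t ht => ?_⟩
  obtain ⟨φ, hφ, heq⟩ := (hκ.periodic t ⟨ht.1, ht.2.trans_lt haT⟩).exists_mem_Ico₀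
    Real.two_pi_pos θ
  rw [heq]
  exact hC (φ, t) ⟨Ico_subset_Icc_self hφ, ht⟩

end IsCurvatureFlowSolution

/-! ### The complex closing condition and the conclusion -/

/-- The closing condition in terms of the real and the imaginary part. -/
theorem integral_inv_mul_cos_sin_eq_zero {k : ℝ → ℝ} (hk : Continuous fun θ => (k θ)⁻¹)
    (hclosed : ∫ θ in (0 : ℝ)..(2 * Real.pi),
      Complex.exp (Complex.I * (θ : ℂ)) / ((k θ : ℝ) : ℂ) = 0) :
    (∫ θ in (0 : ℝ)..(2 * Real.pi), (k θ)⁻¹ * Real.cos θ = 0) ∧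
      ∫ θ in (0 : ℝ)..(2 * Real.pi), (k θ)⁻¹ * Real.sin θ = 0 := by
  have hform : ∀ θ : ℝ, Complex.exp (Complex.I * (θ : ℂ)) / ((k θ : ℝ) : ℂ) =
      ((((k θ)⁻¹ * Real.cos θ : ℝ) : ℂ) + (((k θ)⁻¹ * Real.sin θ : ℝ) : ℂ) * Complex.I) := by
    intro θ
    rw [mul_comm Complex.I, Complex.exp_mul_I]
    push_cast
    ring
  simp only [hform] at hclosed
  have c1 : Continuous fun θ : ℝ => (((k θ)⁻¹ * Real.cos θ : ℝ) : ℂ) :=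
    Complex.continuous_ofReal.comp (hk.mul Real.continuous_cos)
  have c2 : Continuous fun θ : ℝ => (((k θ)⁻¹ * Real.sin θ : ℝ) : ℂ) * Complex.I :=
    (Complex.continuous_ofReal.comp (hk.mul Real.continuous_sin)).mul continuous_const
  rw [intervalIntegral.integral_add (c1.intervalIntegrable _ _)
    (c2.intervalIntegrable _ _), intervalIntegral.integral_mul_const,
    intervalIntegral.integral_ofReal, intervalIntegral.integral_ofReal] at hclosed
  have hre := congrArg Complex.re hclosed
  have him := congrArg Complex.im hclosed
  simp only [Complex.add_re, Complex.ofReal_re, Complex.mul_re, Complex.I_re, mul_zero,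
    Complex.ofReal_im, Complex.I_im, mul_one, sub_self, add_zero, Complex.zero_re, Complex.add_im,
    Complex.mul_im, zero_add, Complex.zero_im] at hre him
  exact ⟨hre, him⟩

theorem mainTheorem7 (T : ℝ) (hT : 0 < T) (κ : ℝ → ℝ → ℝ)
    (hκ : IsCurvatureFlowSolution T κ)
    (hpos : ∀ θ : ℝ, 0 < κ θ 0)
    (hclosed : ∫ θ in (0 : ℝ)..(2 * Real.pi),
      Complex.exp (Complex.I * (θ : ℂ)) / ((κ θ 0 : ℝ) : ℂ) = 0) :
    ∃ C : ℝ, ∀ θ : ℝ, ∀ t ∈ Set.Ico 0 T, |κ θ t| ≤ C := by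
  have hinv : ∀ t ∈ Ico 0 T, Continuous fun θ => (κ θ t)⁻¹ := fun t ht =>
    hκ.continuousOn_inv.continuous_slice_fst (f := fun θ t => (κ θ t)⁻¹) ht
  obtain ⟨hcos, hsin⟩ := integral_inv_mul_cos_sin_eq_zero (hinv 0 ⟨le_rfl, hT⟩) hclosed
  obtain ⟨S', S'', H⟩ := hκ.exists_isNormalSpeed hpos
  -- The support functions start at a positive time, since the speed involves regularity only
  -- available on `(0, T)`.
  obtain ⟨a, ha0, haT⟩ := exists_between hT
  have ha : a ∈ Ico 0 T := ⟨ha0.le, haT⟩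
  have haJ : Ico a T ⊆ Ioo 0 T := fun t ht => ⟨ha0.trans_le ht.1, ht.2⟩
  obtain ⟨h₀, h₀', H₀, hz, hz'⟩ := exists_isSupportFunction (hinv a ha)
    (H.radius_pos · a ⟨ha0, haT⟩) (H.periodic_radius a ⟨ha0, haT⟩)
    ((hκ.integral_inv_mul_cos_eq hpos ha).trans hcos)
    ((hκ.integral_inv_mul_sin_eq hpos ha).trans hsin)
  obtain ⟨h, h', E, hh₀⟩ := H.exists_isSupportEvolution isOpen_Ioo haJ H₀
  obtain ⟨A, hA⟩ : ∃ A, A = ∫ θ in 0..(2 * Real.pi), h₀ θ * (κ θ a)⁻¹ := ⟨_, rfl⟩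
  have hA0 : 0 < A := hA ▸ H₀.integral_mul_radius_pos hz hz'
  obtain ⟨L, hL⟩ : ∃ L, L = ∫ θ in 0..(2 * Real.pi), (κ θ a)⁻¹ := ⟨_, rfl⟩
  have hL0 : 0 < L := hL ▸ H₀.integral_radius_pos
  have harea : ∀ t ∈ Ico a T, ∫ θ in 0..(2 * Real.pi), h θ t * (κ θ t)⁻¹ = A := by
    intro t ht
    rw [hA]
    simp only [← hh₀]
    refine eq_of_hasDerivAt_zero ht.1
      ((continuousOn_intervalIntegral_fst (g := fun θ s => h θ s * (κ θ s)⁻¹) (J := Ico a T)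
        (E.continuousOn.mul (H.continuousOn_radius.mono (prod_mono Subset.rfl haJ))) _ _).mono
        (Icc_subset_Ico_right ht.2))
      (fun s hs => E.hasDerivAt_integral_mul_radius H haJ ⟨hs.1, hs.2.trans ht.2⟩) fun s hs => ?_
    rw [hκ.integral_speed_mul_radius ⟨(ha0.trans hs.1).le, hs.2.trans ht.2⟩, mul_zero]
  have hlength : ∀ t ∈ Ico a T, ∫ θ in 0..(2 * Real.pi), (κ θ t)⁻¹ ≤ L := by
    intro t ht
    rw [hL]
    exact le_of_hasDerivAt_nonpos ht.1
      ((continuousOn_intervalIntegral_fst H.continuousOn_radius _ _).mono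
        ((Icc_subset_Ico_right ht.2).trans haJ))
      (fun s hs => H.hasDerivAt_length isOpen_Ioo ⟨ha0.trans hs.1, hs.2.trans ht.2⟩)
      fun s hs => hκ.integral_speed_nonpos hpos ⟨(ha0.trans hs.1).le, hs.2.trans ht.2⟩
  -- `A` is twice the area and `L` the length at time `a`, so `r` bounds the inradius from below at
  -- all times from `a` on.
  obtain ⟨r, hr⟩ : ∃ r, r = A / 2 / L := ⟨_, rfl⟩
  have hr0 : 0 < r := by rw [hr]; positivity
  obtain ⟨b, hb, hbT⟩ : ∃ b, max a (T - r ^ 2 / 8) < b ∧ b < T :=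
    exists_between (max_lt haT (by linarith [show 0 < r ^ 2 / 8 by positivity]))
  have hab : a ≤ b := (le_max_left _ _).trans hb.le
  have hb8 : T - b ≤ r ^ 2 / 8 := by linarith [(le_max_right a (T - r ^ 2 / 8)).trans hb.le]
  have hbI : b ∈ Ico a T := ⟨hab, hbT⟩
  -- The origin is moved once, to the centroid at time `b`, and then stays fixed; a fixed
  -- translation leaves `ρ` and the speed unchanged.
  obtain ⟨x, y, hxy⟩ := (E.support b hbI).exists_center
  have E' := (E.mono_left hab).sub_center x y
  have hb0 : 0 ≤ b := ha0.le.trans hab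
  have hinside := hκ.half_lt_support hb0 hr0 hb8 E' fun θ => by
    refine le_trans ?_ (hxy θ)
    rw [harea b hbI, hr]
    exact div_le_div_of_nonneg_left (by positivity) (E.support b hbI).integral_radius_pos
      (hlength b hbI)
  -- The radius `r / 4` is half of the lower bound `r / 2` for the support function, which leaves
  -- room to subtract it.
  obtain ⟨M, hM0, hM⟩ := hκ.exists_le_mul_support hpos hb0 hbT
    (r := r / 4) (by positivity) E' fun θ t ht => by linarith [hinside θ t ht]
  obtain ⟨C, hC⟩ := hκ.exists_bound_Icc hbT
  refine ⟨max C (M * L), fun θ t ht => ?_⟩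
  rcases le_total t b with htb | htb
  · exact (hC θ t ⟨ht.1, htb⟩).trans (le_max_left _ _)
  · rw [abs_of_pos (hκ.pos hpos θ t ht)]
    refine ((hM θ t ⟨htb, ht.2⟩).trans ?_).trans (le_max_right _ _)
    refine mul_le_mul_of_nonneg_left ?_ hM0.le
    exact ((E'.support t ⟨htb, ht.2⟩).le_integral_radius
      (fun φ => by linarith [hinside φ t ⟨htb, ht.2⟩]) θ).trans (hlength t ⟨hab.trans htb, ht.2⟩)
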